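/- Fix $T\in[0,\infty)$, $r\ge 0$, $\epsilon\in(0,1)$ and a Borel probability measure $m$ on $[0,\infty)$. Functions in $\mathbb{L}^2([0,T])$ are identified when equal almost everywhere, and integrals of $\mathbb{L}^2([0,T])$-valued functions are Bochner integrals. Let $\mathcal{G}$ be the set of $Q\in\mathbb{L}^2([0,T])$ with $0\le Q(t)\le \frac12$ for a.e. $t\in[0,T]$. For $x\ge 0$ let $Z_x=\{q\in\mathcal{G} : \int_0^T q_t\,dt\le x\}$; let $Z=\{(x,q) : x\ge 0,\ q\in Z_x\}\subseteq[0,\infty)\times\mathbb{L}^2([0,T])$, and let $\mathcal{P}_m(Z)$ be the set of Borel probability measures on $Z$ whose first marginal is $m$. For $Q\in\mathcal{G}$ and $x\ge0$, denote by $q^{Q}(x)$ the unique minimizer over $q\in Z_x$ of $$J^Q(q)=\int_0^T e^{-rt}q_t\,(q_t-1+\epsilon Q_t)\,dt,$$ and set $Q^{Q}=\int_0^\infty q^{Q}(x)\,dm(x)$. A Nash equilibrium is a $Q^*\in\mathcal{G}$ such that $Q^*=Q^{Q^*}$. Proposition. Let $\bar\mu$ be a solution of the potential problem $$\inf_{\mu\in\mathcal{P}_m(Z)}\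 \int_Z\int_0^T e^{-rt}(q_t^2-q_t)\,dt\,d\mu(x,q)+\frac{\epsilon}{2}\int_0^T e^{-rt}\Big(\int_Z q_t\,d\mu(x,q)\Big)^2dt,$$ where $\int_Z q_t\,d\mu(x,q)$ is the value at $t$ of $\int_Z q\,d\mu(x,q)\in\mathbb{L}^2([0,T])$. Then $Q^*=\int_Z q\,d\bar\mu(x,q)$ is a Nash equilibrium; that is, $Q^*\in\mathcal{G}$, the minimizer $q^{Q^*}(x)$ exists and is unique for every $x\ge0$, the map $x\mapsto q^{Q^*}(x)$ is $m$-integrable, and $Q^*=Q^{Q^*}$. -/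

import Mathlib

open MeasureTheory
open scoped NNReal

noncomputable section

namespace ExhaustibleResource

/-- The Hilbert space `L²([0,T], ℝ)`; its elements are classes of functions modulo almost everywhere
equality. -/
abbrev L2 (T : ℝ) : Type := Lp ℝ 2 (volume.restrict (Set.Icc (0 : ℝ) T))

/-- `L²([0,T], ℝ)` carries its Borel sigma-algebra. -/
instance instMeasurableSpaceL2 (T : ℝ) : MeasurableSpace (L2 T) := borel (L2 T)

instance instBorelSpaceL2 (T : ℝ) : BorelSpace (L2 T) := ⟨rfl⟩

/-- The set `𝒢` of the `Q ∈ L²([0,T])` with `0 ≤ Q(t) ≤ 1/2` for (almost) every `t ∈ [0,T]`. -/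
def production (T : ℝ) : Set (L2 T) :=
  {Q | ∀ᵐ t ∂(volume.restrict (Set.Icc (0 : ℝ) T)), 0 ≤ Q t ∧ Q t ≤ 1 / 2}

/-- The feasible controls of a producer with initial stock `x`:
those `q ∈ 𝒢` with `∫₀ᵀ q_t dt ≤ x`. -/
def feasible (T : ℝ) (x : ℝ≥0) : Set (L2 T) :=
  {q | q ∈ production T ∧ ∫ t in Set.Icc (0 : ℝ) T, q t ≤ (x : ℝ)}

/-- The cost `J^Q(q) = ∫₀ᵀ e^{-rt} q_t (q_t - 1 + ε Q_t) dt` of a producer facing the aggregate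
production `Q`. -/
def producerCost (T r ε : ℝ) (Q q : L2 T) : ℝ :=
  ∫ t in Set.Icc (0 : ℝ) T, Real.exp (-r * t) * (q t * (q t - 1 + ε * Q t))

/-- `q` solves the optimal control problem of a producer with initial stock `x`, given the
aggregate production `Q`. -/
def IsOptimalControl (T r ε : ℝ) (Q : L2 T) (x : ℝ≥0) (q : L2 T) : Prop :=
  q ∈ feasible T x ∧ ∀ q' ∈ feasible T x, producerCost T r ε Q q ≤ producerCost T r ε Q q'

/-- `b` is the best-response map `x ↦ q^Q(x)`: for each initial stock `x`, the control `b x` is the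
unique solution of the optimal control problem. -/
def IsBestResponseMap (T r ε : ℝ) (Q : L2 T) (b : ℝ≥0 → L2 T) : Prop :=
  ∀ x : ℝ≥0, ∀ q : L2 T, IsOptimalControl T r ε Q x q ↔ q = b x

/-- `Q` is a Nash equilibrium for the distribution `m` of initial stocks: `Q ∈ 𝒢` and
`Q = ∫ q^Q(x) dm(x)`, an integral in `L²([0,T])` whose existence is part of the claim. -/
def IsNashEquilibrium (T r ε : ℝ) (m : Measure ℝ≥0) (Q : L2 T) : Prop :=
  Q ∈ production T ∧
    ∃ b : ℝ≥0 → L2 T, IsBestResponseMap T r ε Q b ∧ Integrable b m ∧ Q = ∫ x, b x ∂m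

/-- The graph `Z` of the set-valued map `x ↦ feasible T x`, a subset of `[0,∞) × L²([0,T])`. -/
def graphZ (T : ℝ) : Set (ℝ≥0 × L2 T) :=
  {z | z.2 ∈ feasible T z.1}

/-- `𝒫_m(Z)`: the Borel probability measures on `Z` whose first marginal is `m`. -/
def admissible (T : ℝ) (m : Measure ℝ≥0) : Set (Measure (graphZ T)) :=
  {μ | IsProbabilityMeasure μ ∧ μ.map (fun z => z.1.1) = m}

/-- The aggregate `∫_Z q dμ(x,q)`, a Bochner integral in `L²([0,T])`. -/
def aggregate (T : ℝ) (μ : Measure (graphZ T)) : L2 T :=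
  ∫ z, z.1.2 ∂μ

/-- The criterion of the potential problem:
`∫_Z ∫₀ᵀ e^{-rt} (q_t² - q_t) dt dμ(x,q) + (ε/2) ∫₀ᵀ e^{-rt} (∫_Z q_t dμ(x,q))² dt`. -/
def potentialCost (T r ε : ℝ) (μ : Measure (graphZ T)) : ℝ :=
  (∫ z, (∫ t in Set.Icc (0 : ℝ) T, Real.exp (-r * t) * ((z.1.2 t) ^ 2 - z.1.2 t)) ∂μ) +
    ε / 2 * ∫ t in Set.Icc (0 : ℝ) T, Real.exp (-r * t) * (aggregate T μ t) ^ 2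

/-- `μ` solves the potential problem: it minimizes the criterion over `𝒫_m(Z)`. -/
def IsPotentialSolution (T r ε : ℝ) (m : Measure ℝ≥0) (μ : Measure (graphZ T)) : Prop :=
  μ ∈ admissible T m ∧ ∀ ν ∈ admissible T m, potentialCost T r ε μ ≤ potentialCost T r ε ν

end ExhaustibleResource

end

open MeasureTheory Set Filter Topology
open scoped NNReal ENNReal InnerProductSpace

noncomputable section

/-! Let `S` be multiplication by `e^{-rt/2}`. Then `J^Q(q) = ‖Sq‖² - ⟪Sq, S(1 - εQ)⟫`, so minimizing
over `Z_x` is a projection onto a closed convex set, which gives the minimizer `b x` together with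
quadratic growth: `‖S(q - b x)‖² ≤ J^Q(q) - J^Q(b x)`.

The potential is designed so that its derivative at `μ` is the linear functional `ν ↦ ∫ J^{Q*} dν`,
where `Q*` is the aggregate of `μ`. Hence a solution `μ` minimizes this functional over `𝒫_m(Z)`
(`integral_producerCost_le`). Comparison with the image of `m` under `x ↦ (x, b x)`, which is
optimal for every `x`, forces `q = b x` for `μ`-almost every `(x, q)` by quadratic growth
(`ae_eq_bestResponse`). Integrating `q` gives the equilibrium equation. -/

/-- A map whose squared increments are controlled by those of an antitone function factors
continuously through that function, and so is strongly measurable. -/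
theorem stronglyMeasurable_of_dist_sq_le_antitone {α E : Type*} [LinearOrder α]
    [TopologicalSpace α] [OrderClosedTopology α] [MeasurableSpace α] [BorelSpace α] [MetricSpace E]
    {f : α → E} {v : α → ℝ} (hv : Antitone v) (C : ℝ)
    (h : ∀ x y, x ≤ y → dist (f x) (f y) ^ 2 ≤ C * (v x - v y)) : StronglyMeasurable f := by
  have h' : ∀ x y, dist (f x) (f y) ^ 2 ≤ C * |v x - v y| := by
    intro x y
    rcases le_total x y with hxy | hxy
    · simpa [abs_of_nonneg (sub_nonneg.2 (hv hxy))] using h x y hxy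
    · rw [dist_comm, abs_sub_comm, abs_of_nonneg (sub_nonneg.2 (hv hxy))]
      exact h y x hxy
  -- The choice of preimage is immaterial: points with equal `v` have images at distance zero.
  let g : range v → E := fun s => f s.2.choose
  have hg : ∀ s : range v, v s.2.choose = s := fun s => s.2.choose_spec
  have hcont : Continuous g := by
    rw [continuous_iff_continuousAt]
    intro s
    rw [ContinuousAt, tendsto_iff_dist_tendsto_zero]
    have hlim : Tendsto (fun t : range v => √(C * |(t : ℝ) - s|)) (𝓝 s) (𝓝 0) := by
      have : Continuous fun t : range v => √(C * |(t : ℝ) - s|) := by fun_prop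
      simpa using this.tendsto s
    refine squeeze_zero (fun _ => dist_nonneg) (fun t => Real.le_sqrt_of_sq_le ?_) hlim
    simpa only [hg] using h' t.2.choose s.2.choose
  have hfg : f = g ∘ rangeFactorization v := by
    funext x
    have h0 := h' x (rangeFactorization v x).2.choose
    rw [hg] at h0
    have h1 : dist (f x) (g (rangeFactorization v x)) ^ 2 ≤ 0 := by
      simpa [rangeFactorization] using h0
    exact dist_eq_zero.1 (pow_eq_zero_iff two_ne_zero |>.1 (le_antisymm h1 (sq_nonneg _)))
  rw [hfg]
  -- `E` need not be separable; separability comes from `range v ⊆ ℝ`.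
  exact hcont.stronglyMeasurable.comp_measurable (hv.measurable.subtype_mk)

/-- Existence of a strong minimizer for a coercive quadratic functional on a closed convex set. -/
theorem exists_strong_minimizer {H : Type*} [NormedAddCommGroup H] [InnerProductSpace ℝ H]
    [CompleteSpace H] {K : Set H} (hne : K.Nonempty) (hclosed : IsClosed K) (hconv : Convex ℝ K)
    (S : H →L[ℝ] H) {c : ℝ≥0} (hS : AntilipschitzWith c S) (u : H) :
    ∃ b ∈ K, ∀ q ∈ K,
      ‖S (q - b)‖ ^ 2 ≤ (‖S q‖ ^ 2 - ⟪S q, u⟫_ℝ) - (‖S b‖ ^ 2 - ⟪S b, u⟫_ℝ) := by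
  have hcl : IsClosed (S '' K) := (hS.isClosedEmbedding S.uniformContinuous).isClosedMap K hclosed
  have hcv : Convex ℝ (S '' K) := hconv.is_linear_image S.toLinearMap.isLinear
  -- Completing the square, the functional is `‖Sq - u/2‖²` up to a constant, so `S b` is the
  -- projection of `u/2` onto `S '' K`. The variational inequality of the projection supplies the
  -- quadratic growth.
  obtain ⟨_, ⟨b, hb, rfl⟩, hp⟩ := exists_norm_eq_iInf_of_complete_convex (hne.image S)
    hcl.isComplete hcv ((1 / 2 : ℝ) • u)
  rw [norm_eq_iInf_iff_real_inner_le_zero hcv (mem_image_of_mem S hb)] at hp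
  refine ⟨b, hb, fun q hq => ?_⟩
  have h := hp (S q) (mem_image_of_mem S hq)
  simp only [map_sub, ← real_inner_self_eq_norm_sq, inner_sub_left, inner_sub_right,
    real_inner_smul_left] at h ⊢
  rw [real_inner_comm u (S q), real_inner_comm u (S b)] at *
  rw [real_inner_comm (S b) (S q)] at *
  linarith

theorem nonneg_of_forall_linear_add_sq {a b : ℝ}
    (h : ∀ θ : ℝ, 0 < θ → θ ≤ 1 → 0 ≤ θ * a + θ ^ 2 * b) : 0 ≤ a := by
  have hlim : Tendsto (fun θ : ℝ => a + θ * b) (𝓝[>] 0) (𝓝 a) := by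
    have : Continuous fun θ : ℝ => a + θ * b := by fun_prop
    simpa using (this.tendsto 0).mono_left nhdsWithin_le_nhds
  refine ge_of_tendsto hlim ?_
  filter_upwards [Ioc_mem_nhdsGT (zero_lt_one' ℝ)] with θ hθ
  have := h θ hθ.1 hθ.2
  nlinarith [hθ.1, (mul_nonneg_iff_of_pos_left hθ.1).1
    (by linarith : 0 ≤ θ * (a + θ * b))]

namespace ExhaustibleResource

variable {T : ℝ}

/-! ### The exponential weight as an invertible multiplication operator -/

section Multiplication

theorem memLp_exp_mul (T a : ℝ) :
    MemLp (fun t => Real.exp (a * t)) ⊤ (volume.restrict (Icc (0 : ℝ) T)) := by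
  refine memLp_top_of_bound (by fun_prop) (Real.exp (|a| * T)) ?_
  filter_upwards [ae_restrict_mem measurableSet_Icc] with t ht
  rw [Real.norm_eq_abs, Real.abs_exp]
  refine Real.exp_le_exp.2 ?_
  calc a * t ≤ |a| * t := mul_le_mul_of_nonneg_right (le_abs_self a) ht.1
    _ ≤ |a| * T := mul_le_mul_of_nonneg_left ht.2 (abs_nonneg a)

/-- Multiplication by `t ↦ e^{at}` on `L²([0,T])`. -/
def expMul (T a : ℝ) : L2 T →L[ℝ] L2 T :=
  (ContinuousLinearMap.mul ℝ ℝ).holderL (volume.restrict (Icc (0 : ℝ) T)) ⊤ 2 2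
    (memLp_exp_mul T a).toLp

theorem coeFn_expMul (a : ℝ) (f : L2 T) :
    expMul T a f =ᵐ[volume.restrict (Icc (0 : ℝ) T)] fun t => Real.exp (a * t) * f t := by
  have h := ContinuousLinearMap.coeFn_holder (r := 2) (ContinuousLinearMap.mul ℝ ℝ)
    (memLp_exp_mul T a).toLp f
  filter_upwards [h, (memLp_exp_mul T a).coeFn_toLp] with t h1 h2
  change (ContinuousLinearMap.holder 2 (ContinuousLinearMap.mul ℝ ℝ)
    (memLp_exp_mul T a).toLp f : L2 T) t = _
  rw [h1, h2, ContinuousLinearMap.mul_apply']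

theorem expMul_neg_expMul (a : ℝ) (f : L2 T) : expMul T (-a) (expMul T a f) = f := by
  refine Lp.ext ?_
  filter_upwards [coeFn_expMul (-a) (expMul T a f), coeFn_expMul a f] with t h1 h2
  rw [h1, h2, ← mul_assoc, ← Real.exp_add]
  simp

theorem antilipschitz_expMul (T a : ℝ) : AntilipschitzWith ‖expMul T (-a)‖₊ (expMul T a) :=
  (expMul T a).antilipschitz_of_bound fun f => by
    simpa [expMul_neg_expMul] using (expMul T (-a)).le_opNorm (expMul T a f)

/-- The weight `e^{-rt}` is shared equally between the two factors. -/
theorem inner_expMul (r : ℝ) (f g : L2 T) :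
    ⟪expMul T (-r / 2) f, expMul T (-r / 2) g⟫_ℝ =
      ∫ t in Icc (0 : ℝ) T, Real.exp (-r * t) * (f t * g t) := by
  rw [L2.inner_def]
  refine integral_congr_ae ?_
  filter_upwards [coeFn_expMul (-r / 2) f, coeFn_expMul (-r / 2) g] with t h1 h2
  rw [h1, h2, show -r * t = -r / 2 * t + -r / 2 * t by ring, Real.exp_add]
  simp only [RCLike.inner_apply, conj_trivial]
  ring

end Multiplication

/-! ### The convex sets `𝒢` and `Z_x` -/

/-- The constant function `1` in `L²([0,T])`. -/
def oneL2 (T : ℝ) : L2 T := Lp.const 2 (volume.restrict (Icc (0 : ℝ) T)) (1 : ℝ)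

theorem coeFn_oneL2 : ∀ᵐ t ∂(volume.restrict (Icc (0 : ℝ) T)), oneL2 T t = 1 :=
  Lp.coeFn_const 2 (volume.restrict (Icc (0 : ℝ) T)) (1 : ℝ)

theorem inner_oneL2 (q : L2 T) : ⟪oneL2 T, q⟫_ℝ = ∫ t in Icc (0 : ℝ) T, q t := by
  rw [L2.inner_def]
  refine integral_congr_ae ?_
  filter_upwards [coeFn_oneL2 (T := T)] with t h
  simp [h]

/-- As an order interval of a Banach lattice, `𝒢` is closed and norm bounded. -/
theorem production_eq_Icc (T : ℝ) : production T = Icc 0 ((1 / 2 : ℝ) • oneL2 T) := by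
  ext q
  rw [mem_Icc, ← Lp.coeFn_nonneg, ← Lp.coeFn_le]
  have h : ∀ᵐ t ∂(volume.restrict (Icc (0 : ℝ) T)), ((1 / 2 : ℝ) • oneL2 T) t = 1 / 2 := by
    filter_upwards [Lp.coeFn_smul (1 / 2 : ℝ) (oneL2 T), coeFn_oneL2 (T := T)] with t h1 h2
    rw [h1, Pi.smul_apply, h2, smul_eq_mul, mul_one]
  refine ⟨fun hq => ⟨?_, ?_⟩, fun hq => ?_⟩
  · filter_upwards [hq] with t ht using ht.1
  · filter_upwards [hq, h] with t ht h using ht.2.trans_eq h.symm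
  · change ∀ᵐ t ∂_, _
    filter_upwards [hq.1, hq.2, h] with t h0 h1 h using ⟨h0, h1.trans_eq h⟩

theorem isClosed_production (T : ℝ) : IsClosed (production T) :=
  production_eq_Icc T ▸ isClosed_Icc

theorem convex_production (T : ℝ) : Convex ℝ (production T) := by
  intro f hf g hg a b ha hb hab
  change ∀ᵐ t ∂_, _
  filter_upwards [hf, hg, Lp.coeFn_add (a • f) (b • g), Lp.coeFn_smul a f, Lp.coeFn_smul b g]
    with t h1 h2 h3 h4 h5
  rw [h3, Pi.add_apply, h4, h5]
  exact convex_Icc (0 : ℝ) (1 / 2) h1 h2 ha hb hab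

theorem norm_le_of_mem_production {q : L2 T} (hq : q ∈ production T) : ‖q‖ ≤ ‖oneL2 T‖ := by
  rw [production_eq_Icc] at hq
  have h : ‖q‖ ≤ ‖(1 / 2 : ℝ) • oneL2 T‖ := by
    refine norm_le_norm_of_abs_le_abs ?_
    rw [abs_of_nonneg hq.1, abs_of_nonneg (hq.1.trans hq.2)]
    exact hq.2
  rw [norm_smul] at h
  norm_num at h
  linarith [norm_nonneg (oneL2 T)]

theorem feasible_eq (T : ℝ) (x : ℝ≥0) :
    feasible T x = production T ∩ {q | ⟪oneL2 T, q⟫_ℝ ≤ x} := by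
  ext q
  simp only [feasible, mem_ofPred_eq, mem_inter_iff, inner_oneL2]

theorem isClosed_feasible (T : ℝ) (x : ℝ≥0) : IsClosed (feasible T x) := by
  rw [feasible_eq]
  exact (isClosed_production T).inter (isClosed_le (by fun_prop) continuous_const)

theorem convex_feasible (T : ℝ) (x : ℝ≥0) : Convex ℝ (feasible T x) := by
  rw [feasible_eq]
  exact (convex_production T).inter (convex_halfSpace_le (innerₛₗ ℝ (oneL2 T)).isLinear x)

theorem feasible_nonempty (T : ℝ) (x : ℝ≥0) : (feasible T x).Nonempty := by
  refine ⟨0, ?_⟩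
  rw [feasible_eq, production_eq_Icc]
  refine ⟨⟨le_rfl, ?_⟩, by simp⟩
  rw [← Lp.coeFn_nonneg]
  filter_upwards [Lp.coeFn_smul (1 / 2 : ℝ) (oneL2 T), coeFn_oneL2 (T := T)] with t h1 h2
  rw [h1, Pi.smul_apply, h2]
  norm_num

theorem feasible_mono (T : ℝ) : Monotone (feasible T) :=
  fun _ _ hxy _ hq => ⟨hq.1, hq.2.trans (NNReal.coe_le_coe.2 hxy)⟩

/-! ### The cost as a quadratic functional -/

theorem integrable_exp_mul_mul (r : ℝ) (f g : L2 T) :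
    Integrable (fun t => Real.exp (-r * t) * (f t * g t)) (volume.restrict (Icc (0 : ℝ) T)) := by
  have h : Integrable (fun t => f t * g t) (volume.restrict (Icc (0 : ℝ) T)) :=
    (Lp.memLp f).integrable_mul (Lp.memLp g)
  refine memLp_one_iff_integrable.1 ?_
  exact (memLp_one_iff_integrable.2 h).mul (memLp_exp_mul T (-r))

theorem producerCost_eq (r ε : ℝ) (Q q : L2 T) :
    producerCost T r ε Q q = ‖expMul T (-r / 2) q‖ ^ 2 -
      ⟪expMul T (-r / 2) q, expMul T (-r / 2) (oneL2 T - ε • Q)⟫_ℝ := by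
  rw [← real_inner_self_eq_norm_sq, inner_expMul, inner_expMul, ← integral_sub
    (integrable_exp_mul_mul r _ _) (integrable_exp_mul_mul r _ _)]
  refine integral_congr_ae ?_
  filter_upwards [Lp.coeFn_sub (oneL2 T) (ε • Q), Lp.coeFn_smul ε Q, coeFn_oneL2 (T := T)]
    with t h1 h2 h3
  rw [h1, Pi.sub_apply, h2, h3, Pi.smul_apply, smul_eq_mul]
  ring

theorem runningCost_eq (r : ℝ) (q : L2 T) :
    ∫ t in Icc (0 : ℝ) T, Real.exp (-r * t) * ((q t) ^ 2 - q t) = producerCost T r 0 0 q := by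
  refine integral_congr_ae (ae_of_all _ fun t => ?_)
  simp only [zero_mul]
  ring

theorem producerCost_eq_add (r ε : ℝ) (Q q : L2 T) :
    producerCost T r ε Q q = producerCost T r 0 0 q +
      ε * ⟪expMul T (-r / 2) Q, expMul T (-r / 2) q⟫_ℝ := by
  simp only [producerCost_eq, map_sub, map_smul, inner_sub_right, real_inner_smul_right, zero_smul,
    sub_zero]
  rw [real_inner_comm (expMul T (-r / 2) q)]
  ring

theorem continuous_producerCost (r ε : ℝ) (Q : L2 T) : Continuous (producerCost T r ε Q) := by
  simp only [funext (producerCost_eq r ε Q)]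
  fun_prop

/-! ### The best response -/

theorem exists_bestResponse (T r ε : ℝ) (Q : L2 T) (x : ℝ≥0) :
    ∃ b ∈ feasible T x, ∀ q ∈ feasible T x,
      ‖expMul T (-r / 2) (q - b)‖ ^ 2 ≤ producerCost T r ε Q q - producerCost T r ε Q b := by
  simp only [producerCost_eq]
  exact exists_strong_minimizer (feasible_nonempty T x) (isClosed_feasible T x)
    (convex_feasible T x) _ (antilipschitz_expMul T (-r / 2)) _

/-- The best-response map `x ↦ q^Q(x)`. -/
def bestResponse (T r ε : ℝ) (Q : L2 T) (x : ℝ≥0) : L2 T := (exists_bestResponse T r ε Q x).choose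

theorem bestResponse_mem (T r ε : ℝ) (Q : L2 T) (x : ℝ≥0) :
    bestResponse T r ε Q x ∈ feasible T x := (exists_bestResponse T r ε Q x).choose_spec.1

theorem norm_sq_le_producerCost_sub (r ε : ℝ) (Q : L2 T) {x : ℝ≥0} {q : L2 T}
    (hq : q ∈ feasible T x) :
    ‖expMul T (-r / 2) (q - bestResponse T r ε Q x)‖ ^ 2 ≤
      producerCost T r ε Q q - producerCost T r ε Q (bestResponse T r ε Q x) :=
  (exists_bestResponse T r ε Q x).choose_spec.2 q hq

theorem eq_of_norm_expMul_sub_sq_nonpos {a : ℝ} {f g : L2 T}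
    (h : ‖expMul T a (f - g)‖ ^ 2 ≤ 0) : f = g := by
  have h0 : expMul T a (f - g) = 0 :=
    norm_eq_zero.1 (pow_eq_zero_iff two_ne_zero |>.1 (le_antisymm h (sq_nonneg _)))
  rw [map_sub, sub_eq_zero] at h0
  exact (antilipschitz_expMul T a).injective h0

theorem isBestResponseMap_bestResponse (T r ε : ℝ) (Q : L2 T) :
    IsBestResponseMap T r ε Q (bestResponse T r ε Q) := by
  intro x q
  constructor
  · rintro ⟨hq, hmin⟩
    refine eq_of_norm_expMul_sub_sq_nonpos ((norm_sq_le_producerCost_sub r ε Q hq).trans ?_)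
    exact sub_nonpos.2 (hmin _ (bestResponse_mem T r ε Q x))
  · rintro rfl
    exact ⟨bestResponse_mem T r ε Q x, fun q' hq' => sub_nonneg.1
      ((sq_nonneg _).trans (norm_sq_le_producerCost_sub r ε Q hq'))⟩

/-- The sets `Z_x` grow with `x`, so `b x` competes at every `y ≥ x`. Quadratic growth then makes
the optimal value antitone and bounds the squared increments of `b` by its decrease. -/
theorem stronglyMeasurable_bestResponse (T r ε : ℝ) (Q : L2 T) :
    StronglyMeasurable (bestResponse T r ε Q) := by
  have key : ∀ x y, x ≤ y →
      ‖expMul T (-r / 2) (bestResponse T r ε Q x - bestResponse T r ε Q y)‖ ^ 2 ≤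
        producerCost T r ε Q (bestResponse T r ε Q x) -
          producerCost T r ε Q (bestResponse T r ε Q y) := fun x y hxy =>
    norm_sq_le_producerCost_sub r ε Q (feasible_mono T hxy (bestResponse_mem T r ε Q x))
  refine stronglyMeasurable_of_dist_sq_le_antitone
    (v := fun x => producerCost T r ε Q (bestResponse T r ε Q x))
    (fun x y hxy => sub_nonneg.1 ((sq_nonneg _).trans (key x y hxy)))
    ((‖expMul T (-(-r / 2))‖₊ : ℝ) ^ 2) fun x y hxy => ?_
  have h := (antilipschitz_expMul T (-r / 2)).le_mul_dist
    (bestResponse T r ε Q x) (bestResponse T r ε Q y)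
  rw [dist_eq_norm (expMul _ _ _), ← map_sub] at h
  calc dist (bestResponse T r ε Q x) (bestResponse T r ε Q y) ^ 2
      ≤ (‖expMul T (-(-r / 2))‖₊ *
          ‖expMul T (-r / 2) (bestResponse T r ε Q x - bestResponse T r ε Q y)‖) ^ 2 :=
        pow_le_pow_left₀ dist_nonneg h 2
    _ ≤ _ := by
        rw [mul_pow]
        exact mul_le_mul_of_nonneg_left (key x y hxy) (sq_nonneg _)

/-! ### Integrability and aggregation -/

section Integrals

variable {Ω : Type*} [MeasurableSpace Ω] {P : Measure Ω} [IsFiniteMeasure P]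

theorem integrable_of_mem_production {f : Ω → L2 T} (hf : StronglyMeasurable f)
    (hp : ∀ ω, f ω ∈ production T) : Integrable f P :=
  Integrable.of_bound hf.aestronglyMeasurable ‖oneL2 T‖
    (ae_of_all _ fun ω => norm_le_of_mem_production (hp ω))

theorem integrable_producerCost (r ε : ℝ) (Q : L2 T) {f : Ω → L2 T} (hf : StronglyMeasurable f)
    (hp : ∀ ω, f ω ∈ production T) : Integrable (fun ω => producerCost T r ε Q (f ω)) P := by
  set S := expMul T (-r / 2)
  set u := S (oneL2 T - ε • Q)
  refine Integrable.of_bound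
    ((continuous_producerCost r ε Q).comp_stronglyMeasurable hf).aestronglyMeasurable
    ((‖S‖ * ‖oneL2 T‖) ^ 2 + ‖S‖ * ‖oneL2 T‖ * ‖u‖) (ae_of_all _ fun ω => ?_)
  have hS : ‖S (f ω)‖ ≤ ‖S‖ * ‖oneL2 T‖ :=
    (S.le_opNorm _).trans (mul_le_mul_of_nonneg_left (norm_le_of_mem_production (hp ω))
      (norm_nonneg _))
  rw [producerCost_eq]
  refine (norm_sub_le _ _).trans (add_le_add ?_ ?_)
  · rw [norm_pow, norm_norm]
    exact pow_le_pow_left₀ (norm_nonneg _) hS 2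
  · exact (norm_inner_le_norm _ _).trans (mul_le_mul_of_nonneg_right hS (norm_nonneg _))

end Integrals

theorem stronglyMeasurable_control (T : ℝ) :
    StronglyMeasurable (fun z : graphZ T => z.1.2) :=
  -- Finiteness of the exponent gives second countability of `L²`.
  have : Fact ((2 : ℝ≥0∞) ≠ ⊤) := ⟨ENNReal.ofNat_ne_top⟩
  (measurable_snd.comp measurable_subtype_coe).stronglyMeasurable

theorem control_mem_production (z : graphZ T) : z.1.2 ∈ production T := z.2.1

theorem measurable_stock (T : ℝ) : Measurable (fun z : graphZ T => z.1.1) :=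
  measurable_fst.comp measurable_subtype_coe

theorem aggregate_mem_production (μ : Measure (graphZ T)) [IsProbabilityMeasure μ] :
    aggregate T μ ∈ production T :=
  (convex_production T).integral_mem (isClosed_production T) (ae_of_all _ control_mem_production)
    (integrable_of_mem_production (stronglyMeasurable_control T) control_mem_production)

theorem potentialCost_eq (r ε : ℝ) (μ : Measure (graphZ T)) :
    potentialCost T r ε μ = ∫ z, producerCost T r 0 0 z.1.2 ∂μ +
      ε / 2 * ‖expMul T (-r / 2) (aggregate T μ)‖ ^ 2 := by
  rw [← real_inner_self_eq_norm_sq, inner_expMul]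
  simp only [potentialCost, runningCost_eq, ← sq]

/-! ### First-order optimality along mixtures -/

/-- The convex combination `(1 - θ) μ + θ ν`. -/
def mixture {Ω : Type*} [MeasurableSpace Ω] (θ : ℝ) (μ ν : Measure Ω) : Measure Ω :=
  ENNReal.ofReal (1 - θ) • μ + ENNReal.ofReal θ • ν

theorem integral_mixture {Ω E : Type*} [MeasurableSpace Ω] [NormedAddCommGroup E] [NormedSpace ℝ E]
    {θ : ℝ} (h0 : 0 ≤ θ) (h1 : θ ≤ 1) {μ ν : Measure Ω} {f : Ω → E} (hμ : Integrable f μ)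
    (hν : Integrable f ν) :
    ∫ ω, f ω ∂(mixture θ μ ν) = ∫ ω, f ω ∂μ + θ • (∫ ω, f ω ∂ν - ∫ ω, f ω ∂μ) := by
  rw [mixture, integral_add_measure (hμ.smul_measure ENNReal.ofReal_ne_top)
    (hν.smul_measure ENNReal.ofReal_ne_top), integral_smul_measure, integral_smul_measure,
    ENNReal.toReal_ofReal h0, ENNReal.toReal_ofReal (sub_nonneg.2 h1)]
  module

theorem mixture_mem_admissible {m : Measure ℝ≥0} {θ : ℝ} (h0 : 0 ≤ θ) (h1 : θ ≤ 1)
    {μ ν : Measure (graphZ T)} (hμ : μ ∈ admissible T m) (hν : ν ∈ admissible T m) :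
    mixture θ μ ν ∈ admissible T m := by
  obtain ⟨hμ, hμm⟩ := hμ
  obtain ⟨hν, hνm⟩ := hν
  have hsum : ENNReal.ofReal (1 - θ) + ENNReal.ofReal θ = 1 := by
    rw [← ENNReal.ofReal_add (sub_nonneg.2 h1) h0]
    simp
  refine ⟨⟨?_⟩, ?_⟩
  · simp [mixture, hsum]
  · rw [mixture, Measure.map_add _ _ (measurable_stock T), Measure.map_smul, Measure.map_smul,
      hμm, hνm, ← add_smul, hsum, one_smul]

/-- First-order optimality condition: against the aggregate of a solution of the potential problem,
no admissible measure has a lower mean cost. -/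
theorem integral_producerCost_le {r ε : ℝ} {m : Measure ℝ≥0} {μ ν : Measure (graphZ T)}
    (hμ : IsPotentialSolution T r ε m μ) (hν : ν ∈ admissible T m) :
    ∫ z, producerCost T r ε (aggregate T μ) z.1.2 ∂μ ≤
      ∫ z, producerCost T r ε (aggregate T μ) z.1.2 ∂ν := by
  obtain ⟨hμa, hmin⟩ := hμ
  have := hμa.1
  have := hν.1
  set S := expMul T (-r / 2)
  have hI : ∀ (ρ : Measure (graphZ T)) [IsProbabilityMeasure ρ],
      Integrable (fun z : graphZ T => z.1.2) ρ := fun ρ _ =>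
    integrable_of_mem_production (stronglyMeasurable_control T) control_mem_production
  have hC : ∀ (ρ : Measure (graphZ T)) [IsProbabilityMeasure ρ],
      Integrable (fun z : graphZ T => producerCost T r 0 0 z.1.2) ρ := fun ρ _ =>
    integrable_producerCost r 0 0 (stronglyMeasurable_control T) control_mem_production
  have hlin : ∀ (ρ : Measure (graphZ T)) [IsProbabilityMeasure ρ],
      ∫ z, producerCost T r ε (aggregate T μ) z.1.2 ∂ρ =
        ∫ z, producerCost T r 0 0 z.1.2 ∂ρ + ε * ⟪S (aggregate T μ), S (aggregate T ρ)⟫_ℝ := by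
    intro ρ _
    have hS : Integrable (fun z : graphZ T => S z.1.2) ρ := S.integrable_comp (hI ρ)
    simp only [producerCost_eq_add r ε (aggregate T μ)]
    rw [integral_add (hC ρ) ((hS.const_inner _).const_mul ε), integral_const_mul,
      integral_inner hS, S.integral_comp_comm (hI ρ)]
    rfl
  rw [hlin μ, hlin ν, ← sub_nonneg]
  -- The potential is exactly quadratic in `θ` along `(1 - θ) μ + θ ν`; the coefficient of `θ` is
  -- the difference of the two linearized costs.
  have key : ∀ θ : ℝ, 0 < θ → θ ≤ 1 → 0 ≤ θ *
      ((∫ z, producerCost T r 0 0 z.1.2 ∂ν - ∫ z, producerCost T r 0 0 z.1.2 ∂μ) +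
        ε * ⟪S (aggregate T μ), S (aggregate T ν - aggregate T μ)⟫_ℝ) +
      θ ^ 2 * (ε / 2 * ‖S (aggregate T ν - aggregate T μ)‖ ^ 2) := by
    intro θ h0 h1
    have h := hmin _ (mixture_mem_admissible h0.le h1 hμa hν)
    have hagg : aggregate T (mixture θ μ ν) =
        aggregate T μ + θ • (aggregate T ν - aggregate T μ) :=
      integral_mixture h0.le h1 (hI μ) (hI ν)
    rw [potentialCost_eq, potentialCost_eq, integral_mixture h0.le h1 (hC μ) (hC ν), hagg, map_add,
      map_smul, norm_add_sq_real, real_inner_smul_right, norm_smul, mul_pow, Real.norm_eq_abs,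
      sq_abs, smul_eq_mul] at h
    linarith
  have h := nonneg_of_forall_linear_add_sq key
  rw [map_sub, inner_sub_right] at h
  linarith

theorem map_graph_mem_admissible {m : Measure ℝ≥0} [IsProbabilityMeasure m]
    {φ : ℝ≥0 → graphZ T} (hφ : Measurable φ) (hfst : ∀ x, (φ x).1.1 = x) :
    m.map φ ∈ admissible T m := by
  refine ⟨Measure.isProbabilityMeasure_map hφ.aemeasurable, ?_⟩
  rw [Measure.map_map (measurable_stock T) hφ]
  convert Measure.map_id
  exact funext hfst

/-- A solution of the potential problem is carried by the graph of the best-response map. -/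
theorem ae_eq_bestResponse {r ε : ℝ} {m : Measure ℝ≥0} [IsProbabilityMeasure m]
    {μ : Measure (graphZ T)} (hμ : IsPotentialSolution T r ε m μ) :
    ∀ᵐ z ∂μ, z.1.2 = bestResponse T r ε (aggregate T μ) z.1.1 := by
  have := hμ.1.1
  set Q := aggregate T μ
  set b := bestResponse T r ε Q
  have hb : StronglyMeasurable b := stronglyMeasurable_bestResponse T r ε Q
  have hbp : ∀ x, b x ∈ production T := fun x => (bestResponse_mem T r ε Q x).1
  let φ : ℝ≥0 → graphZ T := fun x => ⟨(x, b x), bestResponse_mem T r ε Q x⟩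
  have hφ : Measurable φ := (measurable_id.prodMk hb.measurable).subtype_mk
  have hle := integral_producerCost_le hμ (map_graph_mem_admissible (m := m) hφ fun _ => rfl)
  -- Both measures have first marginal `m`, so the competitor's cost becomes an integral against
  -- `μ`, comparable pointwise.
  have hcost : ∫ z, producerCost T r ε Q z.1.2 ∂(m.map φ) =
      ∫ z : graphZ T, producerCost T r ε Q (b z.1.1) ∂μ := by
    rw [integral_map hφ.aemeasurable ((continuous_producerCost r ε Q).comp_stronglyMeasurable
      (stronglyMeasurable_control T)).aestronglyMeasurable]
    conv_lhs => rw [← hμ.1.2]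
    exact integral_map (measurable_stock T).aemeasurable
      ((continuous_producerCost r ε Q).comp_stronglyMeasurable hb).aestronglyMeasurable
  rw [hcost] at hle
  have hi1 : Integrable (fun z : graphZ T => producerCost T r ε Q z.1.2) μ :=
    integrable_producerCost r ε Q (stronglyMeasurable_control T) control_mem_production
  have hi2 : Integrable (fun z : graphZ T => producerCost T r ε Q (b z.1.1)) μ :=
    integrable_producerCost r ε Q (hb.comp_measurable (measurable_stock T)) fun z => hbp z.1.1
  have hgap : ∀ z : graphZ T, ‖expMul T (-r / 2) (z.1.2 - b z.1.1)‖ ^ 2 ≤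
      producerCost T r ε Q z.1.2 - producerCost T r ε Q (b z.1.1) := fun z =>
    norm_sq_le_producerCost_sub r ε Q z.2
  have hnn : 0 ≤ fun z : graphZ T =>
      producerCost T r ε Q z.1.2 - producerCost T r ε Q (b z.1.1) :=
    fun z => (sq_nonneg _).trans (hgap z)
  have hzero : ∫ z : graphZ T, producerCost T r ε Q z.1.2 - producerCost T r ε Q (b z.1.1) ∂μ = 0 :=
    le_antisymm (by rw [integral_sub hi1 hi2]; exact sub_nonpos.2 hle) (integral_nonneg hnn)
  rw [integral_eq_zero_iff_of_nonneg hnn (hi1.sub hi2)] at hzero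
  filter_upwards [hzero] with z hz
  exact eq_of_norm_expMul_sub_sq_nonpos ((hgap z).trans hz.le)

end ExhaustibleResource

end

open ExhaustibleResource in
theorem proposition7p1 (T r ε : ℝ) (hT : 0 ≤ T) (hr : 0 ≤ r) (hε0 : 0 < ε) (hε1 : ε < 1)
    (m : MeasureTheory.Measure NNReal) (hm : MeasureTheory.IsProbabilityMeasure m)
    (μ : MeasureTheory.Measure (ExhaustibleResource.graphZ T))
    (hμ : ExhaustibleResource.IsPotentialSolution T r ε m μ) :
    ExhaustibleResource.IsNashEquilibrium T r ε m (ExhaustibleResource.aggregate T μ) := by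
  have := hμ.1.1
  have hb := stronglyMeasurable_bestResponse T r ε (aggregate T μ)
  refine ⟨aggregate_mem_production μ, bestResponse T r ε (aggregate T μ),
    isBestResponseMap_bestResponse T r ε _,
    integrable_of_mem_production hb fun x => (bestResponse_mem T r ε _ x).1, ?_⟩
  conv_rhs => rw [← hμ.1.2]
  rw [integral_map (measurable_stock T).aemeasurable hb.aestronglyMeasurable]
  exact integral_congr_ae (ae_eq_bestResponse hμ)
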